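/- **Setting.** Let $N>0$ be an integer, $[N]=\{1,\dots,N\}$, let $\mathcal D$ be a finite non-empty set (of secrets), and let $\mathcal M,\mathcal V$ be sets (of outer queries and of outputs). A permutation challenge game is given by functions $\mathrm{tr}:\mathcal D\times\mathcal M\to[N]$ and $\mathrm{post}:\mathcal D\times[N]\to[N]$, a specification of whether inverse queries are allowed, a fixed finite (possibly empty) list $m^*_1,\dots,m^*_r\in\mathcal M$ of additional outer queries made by the success predicate, and an arbitrary $0/1$ success predicate $\mathrm{suc}$. For a permutation $\sigma$ of $[N]$ and a secret $d\in\mathcal D$, an inner query $i\in[N]$ is answered by $\sigma(i)$ (or, for an inverse query, where these are allowed, by $\sigma^{-1}(i)$), and an outer query $m\in\mathcal M$ is answered by $\mathrm{post}(d,\sigma(\mathrm{tr}(d,m)))$. A (deterministic) non-adaptive algorithm consists of a finite list of queries, fixed in advance, and a function mapping the list of answers to an output $v\in\mathcal V$. It succeeds on $(\sigma,d)$ if $\mathrm{suc}$ outputs $1$ on input $d$, $v$, the list of the algorithm's queries with their answers, and the answers to $m^*_1,\dots,m^*_r$. Its success probability is the probability of this event for a uniformly random permutation $\sigma$ and an independent,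 uniformly random $d\in\mathcal D$. Its query complexity is the number of its (inner and outer) queries plus $r$. Let $\mathrm{MaxS}(T)$ be the optimal (supremal) success probability of a non-adaptive algorithm of query complexity at most $T$; inner queries are allowed here. A non-adaptive $(S,T)$-algorithm with preprocessing is a pair $(A_0,A_1)$ where $A_0$ maps each permutation $\sigma$ to an advice string $z=A_0(\sigma)\in\{0,1\}^s$, for some fixed $s\le S$, and $A_1$ assigns to each $z$ a non-adaptive algorithm $(A_1)_z$, which has query complexity at most $T$ for every $z$ of the form $A_0(\sigma)$. Its success probability is the probability, over uniform independent $\sigma$ and $d$, that $(A_1)_{A_0(\sigma)}$ succeeds on $(\sigma,d)$; the predicate $\mathrm{suc}$ does not receive $z$. **Theorem.** Let $u>0$ be real and suppose that $\mathrm{tr}$ is $u$-uniform, i.e. $|\{d\in\mathcal D:\mathrm{tr}(d,m)=j\}|\le|\mathcal D|/u$ for all $m\in\mathcal M$ and $j\in[N]$. Let $(A_0,A_1)$ be a non-adaptive $(S,T)$-algorithm with preprocessing such that $A_1$ makes no inner queries. Then the success probability of $(A_0,A_1)$ is at most $$\min\left(2\,\mathrm{MaxS}(T)+\frac{4\ln(2)\,ST}{u},\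 \ \mathrm{MaxS}(T)+\sqrt{\frac{\ln(2)\,ST}{u}}\right).$$ -/

import Mathlib

open scoped BigOperators

/-- An oracle query: an inner query `i ↦ σ i`, an inner query `i ↦ σ⁻¹ i` to the inverse
permutation, or an outer query `m`. -/
inductive PCQuery (N : ℕ) (M : Type*) where
  | inner (i : Fin N) : PCQuery N M
  | innerInv (i : Fin N) : PCQuery N M
  | outer (m : M) : PCQuery N M

/-- A permutation challenge game with secret space `D`, outer query space `M` and output
space `V`; the set `[N]` is represented by `Fin N`.

The success predicate is arbitrary. It sees the secret, the output of the online algorithm, the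
transcript of the online algorithm (its queries in order, each with its answer) and the answers to
the predicate's own additional queries. It does not see the advice or the permutation. -/
structure PCGame (N : ℕ) (D M V : Type*) where
  /-- the translation function -/
  tr : D → M → Fin N
  /-- the post-processing function -/
  post : D → Fin N → Fin N
  /-- whether inner queries to the inverse permutation are allowed in this game -/
  allowsInverse : Prop
  /-- additional outer queries, fixed in advance, that the success predicate makes (usually none);
  they are counted in the query complexity -/
  verify : List M
  /-- the 0/1 success predicate -/
  suc : D → V → List (PCQuery N M × Fin N) → List (Fin N) → Bool

/-- A deterministic non-adaptive algorithm: its queries are fixed in advance, and its output is a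
function of the answers. -/
structure OnlineAlg (N : ℕ) (M V : Type*) where
  queries : List (PCQuery N M)
  output : List (Fin N) → V

/-- A deterministic non-adaptive algorithm with preprocessing. The preprocessing part maps the
permutation to an advice string of `adviceLen` bits, and the advice selects the (non-adaptive)
online algorithm. -/
structure PreprocessingAlg (N : ℕ) (M V : Type*) where
  adviceLen : ℕ
  pre : Equiv.Perm (Fin N) → (Fin adviceLen → Bool)
  online : (Fin adviceLen → Bool) → OnlineAlg N M V

namespace PCGame

variable {N : ℕ} {D M V : Type*}

/-- `tr` is `u`-uniform: `|{d | tr d m = j}| ≤ |D| / u` for all `m` and `j`. -/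
def IsUniform [Fintype D] (G : PCGame N D M V) (u : ℝ) : Prop :=
  ∀ (m : M) (j : Fin N),
    ((Finset.univ.filter (fun d : D => G.tr d m = j)).card : ℝ) ≤ (Fintype.card D : ℝ) / u

/-- The oracle with permutation `σ` and secret `d`. -/
def oracle (G : PCGame N D M V) (σ : Equiv.Perm (Fin N)) (d : D) : PCQuery N M → Fin N
  | .inner i => σ i
  | .innerInv i => σ.symm i
  | .outer m => G.post d (σ (G.tr d m))

/-- The outcome of the success predicate when the online algorithm `B` is run with permutation `σ`
and secret `d`. -/
def succeeds (G : PCGame N D M V) (B : OnlineAlg N M V) (σ : Equiv.Perm (Fin N)) (d : D) : Bool :=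
  G.suc d (B.output (B.queries.map (G.oracle σ d)))
    (B.queries.map (fun q => (q, G.oracle σ d q)))
    (G.verify.map (fun m => G.oracle σ d (.outer m)))

/-- `B` is an algorithm for the game `G` of query complexity at most `T`: the inner queries to `σ`
and `σ⁻¹`, the outer queries and the additional queries of the success predicate are at most `T` in
number, and the inverse permutation is queried only if the game allows it. -/
def Admissible (G : PCGame N D M V) (T : ℕ) (B : OnlineAlg N M V) : Prop :=
  B.queries.length + G.verify.length ≤ T ∧
    (¬ G.allowsInverse → ∀ i : Fin N, PCQuery.innerInv i ∉ B.queries)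

/-- Success probability without preprocessing, over a uniform permutation and an independent
uniform secret. -/
noncomputable def successProb [Fintype D] (G : PCGame N D M V) (B : OnlineAlg N M V) : ℝ :=
  𝔼 x : Equiv.Perm (Fin N) × D, if G.succeeds B x.1 x.2 then (1 : ℝ) else 0

/-- The optimal success probability of a non-adaptive algorithm without preprocessing that makes at
most `T` queries (inner and outer). -/
noncomputable def maxS [Fintype D] (G : PCGame N D M V) (T : ℕ) : ℝ :=
  sSup {p : ℝ | ∃ B : OnlineAlg N M V, G.Admissible T B ∧ p = G.successProb B}

/-- Success probability with preprocessing: the online algorithm is given the advice computed from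
the same permutation that defines its oracle. -/
noncomputable def successProbPre [Fintype D] (G : PCGame N D M V) (A : PreprocessingAlg N M V) :
    ℝ :=
  𝔼 x : Equiv.Perm (Fin N) × D,
    if G.succeeds (A.online (A.pre x.1)) x.1 x.2 then (1 : ℝ) else 0

/-- `A` is a (non-adaptive) `(S, T)`-algorithm for the game `G`. -/
def IsSTAlgorithm (G : PCGame N D M V) (S T : ℕ) (A : PreprocessingAlg N M V) : Prop :=
  A.adviceLen ≤ S ∧ ∀ σ : Equiv.Perm (Fin N), G.Admissible T (A.online (A.pre σ))

end PCGame

/-- On every advice string that occurs, the online part makes outer queries only. -/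
def PreprocessingAlg.NoInnerQueries {N : ℕ} {M V : Type*} (A : PreprocessingAlg N M V) : Prop :=
  ∀ (σ : Equiv.Perm (Fin N)), ∀ q ∈ (A.online (A.pre σ)).queries, ∃ m : M, q = PCQuery.outer m

/-! With outer queries only, success for a fixed advice string and secret `d` depends only on `σ`
restricted to the set `Q d` of translated queries. By uniformity and a union bound, each point lies
in at most κ = T|D|/u of these sets. Conditioning on the advice replaces the uniform law by a
density `f` of relative entropy log(n/k), where n counts all permutations and k those with this
advice. By `shearer_perm`, the relative entropies of the marginals on the `Q d` add up to at most 2κ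
times that of `f`. A Donsker–Varadhan bound converts marginal entropy into a change of success
probability, and averaged over the advice log(n/k) is at most S ln 2. A multiplicative or a
Hoeffding estimate of the moment generating function gives the two bounds.

`shearer_perm` is proved by symmetrisation. Averaging `f` with its left translate by a transposition
(a b) lowers the entropy by a sum of Jensen gaps. The marginal on `Q d` loses entropy only where
σ⁻¹a or σ⁻¹b lies in `Q d`, and there at most the conditional average of the loss of `f`, by joint
convexity of the gap. Two positions, each counted at most κ times, give 2κ. So the defect never
decreases, and compactness carries it to the uniform density, where it vanishes. -/

/-! ### Joint convexity of the Jensen gap of x log x -/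

/-- The Jensen gap of `x ↦ x * log x` at the midpoint of two points. -/
noncomputable def entropyGap (x y : ℝ) : ℝ :=
  (x * Real.log x + y * Real.log y) / 2 - (x + y) / 2 * Real.log ((x + y) / 2)

/-- Tangent plane at (X, M) of the jointly convex function x log(x/m); it comes from log t ≤ t - 1
at t = mX/(xM). -/
theorem mul_log_sub_mul_log_ge {x m X M : ℝ} (hx : 0 ≤ x) (hm : 0 ≤ m) (hxm : m = 0 → x = 0)
    (hX : 0 < X) (hM : 0 < M) :
    x * (Real.log X - Real.log M) + x - m * (X / M) ≤ x * Real.log x - x * Real.log m := by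
  rcases hx.eq_or_lt with rfl | hx
  · have : 0 ≤ m * (X / M) := by positivity
    simp; linarith
  have hm' : 0 < m := lt_of_le_of_ne hm (fun h => hx.ne' (hxm h.symm))
  have h := Real.log_le_sub_one_of_pos (x := m * X / (x * M)) (by positivity)
  rw [Real.log_div (by positivity) (by positivity), Real.log_mul (by positivity) (by positivity),
    Real.log_mul (by positivity) (by positivity)] at h
  have h2 := mul_le_mul_of_nonneg_left h hx.le
  have h3 : x * (m * X / (x * M) - 1) = m * (X / M) - x := by field_simp
  linarith

theorem log_sum_inequality {ι : Type*} {s : Finset ι} {x m : ι → ℝ}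
    (hx : ∀ i ∈ s, 0 ≤ x i) (hxm : ∀ i ∈ s, x i ≤ 2 * m i) :
    (𝔼 i ∈ s, x i) * Real.log (𝔼 i ∈ s, x i) - (𝔼 i ∈ s, x i) * Real.log (𝔼 i ∈ s, m i) ≤
      𝔼 i ∈ s, (x i * Real.log (x i) - x i * Real.log (m i)) := by
  have hX0 : 0 ≤ 𝔼 i ∈ s, x i := Finset.expect_nonneg hx
  rcases hX0.eq_or_lt with hX | hX
  · have h0 : ∀ i ∈ s, x i = 0 := (Finset.expect_eq_zero_iff_of_nonneg hx).1 hX.symm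
    have h1 : 𝔼 i ∈ s, (x i * Real.log (x i) - x i * Real.log (m i)) = 0 :=
      Finset.expect_eq_zero fun i hi => by simp [h0 i hi]
    rw [h1, ← hX]
    simp
  -- The bound x ≤ 2m supplies absolute continuity: m cannot vanish where x does not.
  have hM : 0 < 𝔼 i ∈ s, m i := by
    have : 𝔼 i ∈ s, x i ≤ 𝔼 i ∈ s, 2 * m i := Finset.expect_le_expect hxm
    rw [← Finset.mul_expect] at this
    linarith
  set X := 𝔼 i ∈ s, x i
  set M := 𝔼 i ∈ s, m i
  have key : 𝔼 i ∈ s, (x i * (Real.log X - Real.log M) + x i - m i * (X / M)) ≤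
      𝔼 i ∈ s, (x i * Real.log (x i) - x i * Real.log (m i)) :=
    Finset.expect_le_expect fun i hi => mul_log_sub_mul_log_ge (hx i hi)
      (by linarith [hx i hi, hxm i hi])
      (fun h => le_antisymm (by linarith [hxm i hi]) (hx i hi)) hX hM
  rw [Finset.expect_sub_distrib, Finset.expect_add_distrib, ← Finset.expect_mul,
    ← Finset.expect_mul] at key
  have : M * (X / M) = X := by field_simp
  change X * _ + X - M * (X / M) ≤ _ at key
  linarith

theorem entropyGap_eq (x y : ℝ) : entropyGap x y =
    ((x * Real.log x - x * Real.log ((x + y) / 2)) +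
      (y * Real.log y - y * Real.log ((x + y) / 2))) / 2 := by
  unfold entropyGap; ring

theorem entropyGap_self (x : ℝ) : entropyGap x x = 0 := by
  have : (x + x) / 2 = x := by ring
  rw [entropyGap_eq, this]; ring

/-- The gap is half the sum of the divergences of x and of y from their midpoint, so the log-sum
inequality applies to each half. -/
theorem entropyGap_expect_le {ι : Type*} {s : Finset ι} {x y : ι → ℝ}
    (hx : ∀ i ∈ s, 0 ≤ x i) (hy : ∀ i ∈ s, 0 ≤ y i) :
    entropyGap (𝔼 i ∈ s, x i) (𝔼 i ∈ s, y i) ≤ 𝔼 i ∈ s, entropyGap (x i) (y i) := by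
  have h1 := log_sum_inequality (m := fun i => (x i + y i) / 2) hx
    (fun i hi => by linarith [hy i hi])
  have h2 := log_sum_inequality (m := fun i => (x i + y i) / 2) hy
    (fun i hi => by linarith [hx i hi])
  have hm : 𝔼 i ∈ s, (x i + y i) / 2 = ((𝔼 i ∈ s, x i) + 𝔼 i ∈ s, y i) / 2 := by
    rw [← Finset.expect_div, Finset.expect_add_distrib]
  rw [hm] at h1 h2
  rw [entropyGap_eq]
  simp_rw [entropyGap_eq]
  rw [← Finset.expect_div, Finset.expect_add_distrib]
  linarith

theorem entropyGap_nonneg {x y : ℝ} (hx : 0 ≤ x) (hy : 0 ≤ y) : 0 ≤ entropyGap x y := by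
  have h := Real.convexOn_mul_log.2 (Set.mem_Ici.2 hx) (Set.mem_Ici.2 hy)
    (by norm_num : (0 : ℝ) ≤ 1 / 2) (by norm_num : (0 : ℝ) ≤ 1 / 2) (by norm_num)
  simp only [smul_eq_mul] at h
  have e : 1 / 2 * x + 1 / 2 * y = (x + y) / 2 := by ring
  rw [e] at h
  unfold entropyGap
  linarith

/-! ### Shearer inequality for permutations -/

section PermutationShearer

variable {α : Type*} [Fintype α] [DecidableEq α]

/-- The permutations that fix every point of `Q`. -/
def pointwiseFixer (Q : Finset α) : Finset (Equiv.Perm α) :=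
  Finset.univ.filter fun ρ => ∀ i ∈ Q, ρ i = i

theorem mem_pointwiseFixer {Q : Finset α} {ρ : Equiv.Perm α} :
    ρ ∈ pointwiseFixer Q ↔ ∀ i ∈ Q, ρ i = i := by
  simp [pointwiseFixer]

theorem pointwiseFixer_nonempty (Q : Finset α) : (pointwiseFixer Q).Nonempty :=
  ⟨1, by simp [mem_pointwiseFixer]⟩

/-- The conditional expectation of `f` given the restriction of the permutation to `Q`. -/
noncomputable def condAvg (Q : Finset α) (f : Equiv.Perm α → ℝ) (σ : Equiv.Perm α) : ℝ :=
  𝔼 ρ ∈ pointwiseFixer Q, f (σ * ρ)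

/-- The mean of `f` and its left translate by `τ`. -/
noncomputable def leftMean (τ : Equiv.Perm α) (f : Equiv.Perm α → ℝ) (σ : Equiv.Perm α) : ℝ :=
  (f σ + f (τ * σ)) / 2

/-- The sum of `f * log f`. -/
noncomputable def sumMulLog (f : Equiv.Perm α → ℝ) : ℝ := ∑ σ, f σ * Real.log (f σ)

theorem condAvg_leftMean (Q : Finset α) (τ : Equiv.Perm α) (f : Equiv.Perm α → ℝ) :
    condAvg Q (leftMean τ f) = leftMean τ (condAvg Q f) := by
  ext σ
  simp only [condAvg, leftMean, mul_assoc]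
  rw [← Finset.expect_div, Finset.expect_add_distrib]

theorem sum_translate_left (τ : Equiv.Perm α) (f : Equiv.Perm α → ℝ) :
    ∑ σ, f (τ * σ) = ∑ σ, f σ :=
  Fintype.sum_equiv (Equiv.mulLeft τ) _ _ fun _ => rfl

theorem sum_translate_right (ρ : Equiv.Perm α) (f : Equiv.Perm α → ℝ) :
    ∑ σ, f (σ * ρ) = ∑ σ, f σ :=
  Fintype.sum_equiv (Equiv.mulRight ρ) _ _ fun _ => rfl

/-- Averaging over cosets of the pointwise stabiliser is invisible to test functions constant on
those cosets. -/
theorem sum_condAvg_mul (Q : Finset α) (f g : Equiv.Perm α → ℝ)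
    (hg : ∀ σ, ∀ ρ ∈ pointwiseFixer Q, g (σ * ρ) = g σ) :
    ∑ σ, condAvg Q f σ * g σ = ∑ σ, f σ * g σ := by
  have : ∀ σ, condAvg Q f σ * g σ = 𝔼 ρ ∈ pointwiseFixer Q, f (σ * ρ) * g (σ * ρ) := fun σ => by
    rw [condAvg, Finset.expect_mul]
    exact Finset.expect_congr rfl fun ρ hρ => by rw [hg σ ρ hρ]
  simp_rw [this]
  rw [← Finset.expect_sum_comm]
  rw [Finset.expect_congr rfl fun ρ _ => sum_translate_right ρ fun σ => f σ * g σ]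
  exact Finset.expect_const (pointwiseFixer_nonempty Q) _

theorem sum_condAvg (Q : Finset α) (f : Equiv.Perm α → ℝ) :
    ∑ σ, condAvg Q f σ = ∑ σ, f σ := by
  simpa using sum_condAvg_mul Q f (fun _ => 1) (fun _ _ _ => rfl)

theorem condAvg_nonneg (Q : Finset α) {f : Equiv.Perm α → ℝ} (hf : ∀ σ, 0 ≤ f σ)
    (σ : Equiv.Perm α) : 0 ≤ condAvg Q f σ :=
  Finset.expect_nonneg fun _ _ => hf _

theorem sumMulLog_sub_leftMean (τ : Equiv.Perm α) (f : Equiv.Perm α → ℝ) :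
    sumMulLog f - sumMulLog (leftMean τ f) = ∑ σ, entropyGap (f σ) (f (τ * σ)) := by
  have h := sum_translate_left τ fun σ => f σ * Real.log (f σ)
  simp only [entropyGap, sumMulLog, leftMean, Finset.sum_sub_distrib, ← Finset.sum_div,
    Finset.sum_add_distrib, h]
  ring

/-- Moved to the right of σ, the transposition becomes that of σ⁻¹a and σ⁻¹b. It fixes `Q`
pointwise, so the average absorbs it. -/
theorem condAvg_swap_mul {Q : Finset α} {a b : α} {f : Equiv.Perm α → ℝ} {σ : Equiv.Perm α}
    (ha : σ.symm a ∉ Q) (hb : σ.symm b ∉ Q) :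
    condAvg Q f (Equiv.swap a b * σ) = condAvg Q f σ := by
  set π := Equiv.swap (σ.symm a) (σ.symm b) with hπ
  have hfix : ∀ i ∈ Q, π i = i := fun i hi =>
    Equiv.swap_apply_of_ne_of_ne (fun h => ha (h ▸ hi)) (fun h => hb (h ▸ hi))
  have hmul : Equiv.swap a b * σ = σ * π := by
    have := Equiv.mul_swap_eq_swap_mul σ (σ.symm a) (σ.symm b)
    simpa using this.symm
  rw [hmul, condAvg, condAvg]
  refine Finset.expect_bij (fun ρ _ => π * ρ) ?_ ?_ ?_ ?_
  · intro ρ hρ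
    rw [mem_pointwiseFixer] at hρ ⊢
    intro i hi
    rw [Equiv.Perm.mul_apply, hρ i hi, hfix i hi]
  · intro ρ _
    rw [mul_assoc]
  · intro _ _ _ _ h
    exact mul_left_cancel h
  · intro ρ hρ
    rw [mem_pointwiseFixer] at hρ
    refine ⟨π * ρ, ?_, ?_⟩
    · rw [mem_pointwiseFixer]
      intro i hi
      rw [Equiv.Perm.mul_apply, hρ i hi, hfix i hi]
    · simp [hπ]

theorem sum_entropyGap_condAvg_le (Q : Finset α) (a b : α) {f : Equiv.Perm α → ℝ}
    (hf : ∀ σ, 0 ≤ f σ) :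
    ∑ σ, entropyGap (condAvg Q f σ) (condAvg Q f (Equiv.swap a b * σ)) ≤
      ∑ σ : Equiv.Perm α, entropyGap (f σ) (f (Equiv.swap a b * σ)) *
        ((if σ.symm a ∈ Q then 1 else 0) + if σ.symm b ∈ Q then 1 else 0) := by
  set τ := Equiv.swap a b
  set g : Equiv.Perm α → ℝ := fun σ =>
    (if σ.symm a ∈ Q then 1 else 0) + if σ.symm b ∈ Q then 1 else 0
  have hmem : ∀ (σ : Equiv.Perm α), ∀ ρ ∈ pointwiseFixer Q, ∀ c,
      (σ * ρ).symm c ∈ Q ↔ σ.symm c ∈ Q := by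
    intro σ ρ hρ c
    rw [mem_pointwiseFixer] at hρ
    have e : (σ * ρ).symm c = ρ.symm (σ.symm c) := rfl
    rw [e]
    constructor
    · intro h
      have := hρ _ h
      rw [Equiv.apply_symm_apply] at this
      rwa [this]
    · intro h
      have : ρ.symm (σ.symm c) = σ.symm c := by
        rw [Equiv.symm_apply_eq]; exact (hρ _ h).symm
      rwa [this]
  rw [← sum_condAvg_mul Q (fun σ => entropyGap (f σ) (f (τ * σ))) g]
  · refine Finset.sum_le_sum fun σ _ => ?_
    -- If neither preimage lies in `Q`, the gap is zero; otherwise the weight `g σ` is at least 1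
    -- and joint convexity suffices.
    by_cases h : σ.symm a ∉ Q ∧ σ.symm b ∉ Q
    · rw [condAvg_swap_mul h.1 h.2, entropyGap_self]
      simp [g, h.1, h.2]
    · have hg : 1 ≤ g σ := by
        simp only [g]
        split_ifs <;> first | exact absurd ⟨‹_›, ‹_›⟩ h | norm_num
      have h1 : entropyGap (condAvg Q f σ) (condAvg Q f (τ * σ)) ≤
          condAvg Q (fun σ => entropyGap (f σ) (f (τ * σ))) σ := by
        simp only [condAvg, mul_assoc]
        exact entropyGap_expect_le (fun _ _ => hf _) fun _ _ => hf _
      exact h1.trans (le_mul_of_one_le_right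
        (condAvg_nonneg Q (fun σ => entropyGap_nonneg (hf _) (hf _)) σ) hg)
  · intro σ ρ hρ
    simp only [g, hmem σ ρ hρ]

variable {ι : Type*} [Fintype ι]

theorem sum_entropyGap_family_le (Q : ι → Finset α) {κ : ℝ}
    (hκ : ∀ j, ((Finset.univ.filter fun d => j ∈ Q d).card : ℝ) ≤ κ) (a b : α)
    {f : Equiv.Perm α → ℝ} (hf : ∀ σ, 0 ≤ f σ) :
    ∑ d, ∑ σ, entropyGap (condAvg (Q d) f σ) (condAvg (Q d) f (Equiv.swap a b * σ)) ≤
      2 * κ * ∑ σ : Equiv.Perm α, entropyGap (f σ) (f (Equiv.swap a b * σ)) := by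
  refine (Finset.sum_le_sum fun d _ => sum_entropyGap_condAvg_le (Q d) a b hf).trans ?_
  rw [Finset.sum_comm, Finset.mul_sum]
  refine Finset.sum_le_sum fun σ _ => ?_
  rw [← Finset.mul_sum, Finset.sum_add_distrib, mul_comm]
  refine mul_le_mul_of_nonneg_right ?_ (entropyGap_nonneg (hf _) (hf _))
  have h1 := hκ (σ.symm a)
  have h2 := hκ (σ.symm b)
  rw [Finset.sum_boole, Finset.sum_boole]
  linarith

/-- The defect of the Shearer inequality for the density `f`. -/
noncomputable def shearerDefect (Q : ι → Finset α) (κ : ℝ) (f : Equiv.Perm α → ℝ) : ℝ :=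
  ∑ d, sumMulLog (condAvg (Q d) f) - 2 * κ * sumMulLog f

theorem shearerDefect_le_leftMean (Q : ι → Finset α) {κ : ℝ}
    (hκ : ∀ j, ((Finset.univ.filter fun d => j ∈ Q d).card : ℝ) ≤ κ) (a b : α)
    {f : Equiv.Perm α → ℝ} (hf : ∀ σ, 0 ≤ f σ) :
    shearerDefect Q κ f ≤ shearerDefect Q κ (leftMean (Equiv.swap a b) f) := by
  have h := sum_entropyGap_family_le Q hκ a b hf
  simp_rw [← sumMulLog_sub_leftMean] at h
  rw [Finset.sum_sub_distrib] at h
  simp only [shearerDefect, condAvg_leftMean]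
  linarith

theorem continuous_sumMulLog : Continuous (sumMulLog : (Equiv.Perm α → ℝ) → ℝ) :=
  continuous_finsetSum _ fun σ _ => Real.continuous_mul_log.comp (continuous_apply σ)

theorem continuous_condAvg (Q : Finset α) :
    Continuous (condAvg Q : (Equiv.Perm α → ℝ) → Equiv.Perm α → ℝ) := by
  refine continuous_pi fun σ => ?_
  simp only [condAvg, Finset.expect_eq_sum_div_card]
  fun_prop

theorem continuous_shearerDefect (Q : ι → Finset α) (κ : ℝ) :
    Continuous (shearerDefect Q κ) :=
  (continuous_finsetSum _ fun d _ => continuous_sumMulLog.comp (continuous_condAvg (Q d))).sub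
    (continuous_const.mul continuous_sumMulLog)

/-- Densities with respect to the uniform distribution on permutations. -/
def permDensities (α : Type*) [Fintype α] [DecidableEq α] : Set (Equiv.Perm α → ℝ) :=
  {f | (∀ σ, 0 ≤ f σ) ∧ ∑ σ, f σ = Fintype.card (Equiv.Perm α)}

theorem isCompact_permDensities : IsCompact (permDensities α) := by
  refine (isCompact_Icc (a := (0 : Equiv.Perm α → ℝ))
    (b := fun _ => (Fintype.card (Equiv.Perm α) : ℝ))).of_isClosed_subset ?_ ?_
  · refine IsClosed.inter (s₁ := {f : Equiv.Perm α → ℝ | ∀ σ, 0 ≤ f σ}) ?_ ?_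
    · simp only [Set.ofPred_forall]
      exact isClosed_iInter fun σ => isClosed_le continuous_const (continuous_apply σ)
    · exact isClosed_eq (by fun_prop) continuous_const
  · rintro f ⟨h0, h1⟩
    refine ⟨h0, fun σ => ?_⟩
    rw [← h1]
    exact Finset.single_le_sum (fun i _ => h0 i) (Finset.mem_univ σ)

theorem leftMean_mem_permDensities (τ : Equiv.Perm α) {f : Equiv.Perm α → ℝ}
    (hf : f ∈ permDensities α) : leftMean τ f ∈ permDensities α := by
  refine ⟨fun σ => ?_, ?_⟩
  · have := hf.1 σ
    have := hf.1 (τ * σ)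
    unfold leftMean; positivity
  · simp only [leftMean, ← Finset.sum_div, Finset.sum_add_distrib, sum_translate_left]
    rw [hf.2]; ring

theorem eq_one_of_swap_invariant {f : Equiv.Perm α → ℝ} (hf : f ∈ permDensities α)
    (h : ∀ a b σ, f (Equiv.swap a b * σ) = f σ) : f = fun _ => 1 := by
  have hc : ∀ σ, f σ = f 1 := fun σ => by
    induction σ using Equiv.Perm.swap_induction_on with
    | one => rfl
    | swap_mul g x y _ ih => rw [h, ih]
  have h2 := hf.2
  simp_rw [hc] at h2
  rw [Finset.sum_const, Finset.card_univ, nsmul_eq_mul] at h2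
  have h3 : (Fintype.card (Equiv.Perm α) : ℝ) ≠ 0 := by exact_mod_cast Fintype.card_ne_zero
  have h4 : f 1 = 1 := by
    apply mul_left_cancel₀ h3
    rw [h2, mul_one]
  ext σ
  rw [hc, h4]

theorem sum_sq_leftMean (τ : Equiv.Perm α) (f : Equiv.Perm α → ℝ) :
    ∑ σ, leftMean τ f σ ^ 2 = ∑ σ, f σ ^ 2 - ∑ σ, (f σ - f (τ * σ)) ^ 2 / 4 := by
  have h := sum_translate_left τ fun σ => f σ ^ 2
  have e : ∀ σ, leftMean τ f σ ^ 2 =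
      (f σ ^ 2 / 2 + f (τ * σ) ^ 2 / 2) - (f σ - f (τ * σ)) ^ 2 / 4 := fun σ => by
    unfold leftMean; ring
  simp_rw [e]
  rw [Finset.sum_sub_distrib, Finset.sum_add_distrib, ← Finset.sum_div, ← Finset.sum_div, h]
  ring

theorem shearerDefect_one (Q : ι → Finset α) (κ : ℝ) :
    shearerDefect Q κ (fun _ => 1) = 0 := by
  have h : ∀ d, condAvg (Q d) (fun _ => (1 : ℝ)) = fun _ => 1 := fun d => by
    ext σ; exact Finset.expect_const (pointwiseFixer_nonempty _) _
  simp [shearerDefect, h, sumMulLog]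

/-- A Shearer-type inequality for permutations, with a loss of a factor of two compared to
product distributions. -/
theorem shearer_perm (Q : ι → Finset α) {κ : ℝ}
    (hκ : ∀ j, ((Finset.univ.filter fun d => j ∈ Q d).card : ℝ) ≤ κ)
    {f : Equiv.Perm α → ℝ} (hf : f ∈ permDensities α) :
    ∑ d, sumMulLog (condAvg (Q d) f) ≤ 2 * κ * sumMulLog f := by
  obtain ⟨g, hg, hmax⟩ := isCompact_permDensities.exists_isMaxOn ⟨f, hf⟩
    (continuous_shearerDefect Q κ).continuousOn
  -- This is the set of maximisers of the defect. Averaging need not increase the defect strictly,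
  -- so ties are broken by the least sum of squares, which drops strictly unless the density is
  -- swap-invariant.
  have hK : IsCompact (permDensities α ∩ {h | shearerDefect Q κ g ≤ shearerDefect Q κ h}) :=
    isCompact_permDensities.inter_right
      (isClosed_le continuous_const (continuous_shearerDefect Q κ))
  obtain ⟨k, ⟨hk, hgk⟩, hmin⟩ := hK.exists_isMinOn (f := fun h => ∑ σ, h σ ^ 2) ⟨g, hg, le_refl (shearerDefect Q κ g)⟩
    (by fun_prop)
  have hk1 : k = fun _ => 1 := by
    refine eq_one_of_swap_invariant hk fun a b σ => ?_
    have h1 := hmin (a := leftMean (Equiv.swap a b) k)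
      ⟨leftMean_mem_permDensities _ hk,
        le_trans hgk (shearerDefect_le_leftMean Q hκ a b hk.1)⟩
    simp only [Set.mem_ofPred_eq, sum_sq_leftMean] at h1
    have h2 : ∑ σ, (k σ - k (Equiv.swap a b * σ)) ^ 2 / 4 = 0 :=
      le_antisymm (by linarith) (Finset.sum_nonneg fun _ _ => by positivity)
    rw [Finset.sum_eq_zero_iff_of_nonneg fun _ _ => by positivity] at h2
    have h3 := h2 σ (Finset.mem_univ _)
    have h4 : (k σ - k (Equiv.swap a b * σ)) ^ 2 = 0 := by linarith
    linarith [pow_eq_zero_iff (two_ne_zero) |>.1 h4]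
  have h1 : shearerDefect Q κ f ≤ 0 := by
    rw [← shearerDefect_one Q κ, ← hk1]
    exact le_trans (hmax hf) hgk
  unfold shearerDefect at h1
  linarith

end PermutationShearer

/-! ### Exponential moments and duality -/

/-- Hoeffding's lemma for the two-point law on {0, 1} with mean q. -/
theorem bernoulli_mgf_le {q : ℝ} (h0 : 0 ≤ q) (h1 : q ≤ 1) (l : ℝ) :
    1 + q * (Real.exp l - 1) ≤ Real.exp (l * q + l ^ 2 / 8) := by
  set μ : MeasureTheory.Measure ℝ := ENNReal.ofReal (1 - q) • MeasureTheory.Measure.dirac 0 +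
    ENNReal.ofReal q • MeasureTheory.Measure.dirac 1 with hμ
  have hprob : MeasureTheory.IsProbabilityMeasure μ := ⟨by
    simp only [hμ, MeasureTheory.Measure.add_apply, MeasureTheory.Measure.smul_apply,
      MeasureTheory.measure_univ, smul_eq_mul, mul_one]
    rw [← ENNReal.ofReal_add (by linarith) h0]
    simp⟩
  have hint : ∀ g : ℝ → ℝ, Continuous g → ∫ x, g x ∂μ = (1 - q) * g 0 + q * g 1 := by
    intro g hg
    have hd : ∀ a : ℝ, MeasureTheory.Integrable g (MeasureTheory.Measure.dirac a) := fun a =>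
      MeasureTheory.integrable_dirac (by simp)
    rw [hμ, MeasureTheory.integral_add_measure ((hd 0).smul_measure ENNReal.ofReal_ne_top)
      ((hd 1).smul_measure ENNReal.ofReal_ne_top), MeasureTheory.integral_smul_measure,
      MeasureTheory.integral_smul_measure, MeasureTheory.integral_dirac,
      MeasureTheory.integral_dirac, ENNReal.toReal_ofReal (by linarith), ENNReal.toReal_ofReal h0]
    simp
  have hmem : ∀ᵐ x ∂μ, x ∈ Set.Icc (0 : ℝ) 1 := by
    rw [hμ, MeasureTheory.ae_add_measure_iff]
    exact ⟨MeasureTheory.Measure.ae_smul_measure (by simp [MeasureTheory.ae_dirac_eq]) _,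
      MeasureTheory.Measure.ae_smul_measure (by simp [MeasureTheory.ae_dirac_eq]) _⟩
  have h := (ProbabilityTheory.hasSubgaussianMGF_of_mem_Icc (X := fun x : ℝ => x)
    aemeasurable_id hmem).mgf_le l
  rw [hint (fun x => x) continuous_id, ProbabilityTheory.mgf, hint _ (by fun_prop)] at h
  have e : ∀ t : ℝ, Real.exp (l * (t - q)) = Real.exp (l * t) * Real.exp (-(l * q)) := fun t => by
    rw [← Real.exp_add]; ring_nf
  simp only [mul_zero, mul_one, zero_add, e, Real.exp_zero, one_mul] at h
  rw [Real.exp_add]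
  have h3 := mul_le_mul_of_nonneg_left h (Real.exp_pos (l * q)).le
  have h4 : Real.exp (l * q) * Real.exp (-(l * q)) = 1 := by rw [← Real.exp_add]; simp
  calc 1 + q * (Real.exp l - 1)
      = (Real.exp (l * q) * Real.exp (-(l * q))) * (1 + q * (Real.exp l - 1)) := by
        rw [h4, one_mul]
    _ = Real.exp (l * q) *
        ((1 - q) * Real.exp (-(l * q)) + q * (Real.exp l * Real.exp (-(l * q)))) := by ring
    _ ≤ _ := h3
    _ = _ := by
      norm_num
      ring_nf

/-- Fenchel–Young: x log x - x and exp are convex conjugates. -/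
theorem mul_le_mul_log_sub_add_exp {x : ℝ} (hx : 0 ≤ x) (y : ℝ) :
    x * y ≤ x * Real.log x - x + Real.exp y := by
  rcases hx.eq_or_lt with rfl | hx
  · simpa using (Real.exp_pos y).le
  have h := Real.add_one_le_exp (y - Real.log x)
  rw [Real.exp_sub, Real.exp_log hx, le_div_iff₀ hx] at h
  linarith

/-! ### From entropy to probabilities of local events -/

section PermutationEntropy

variable {α : Type*} [Fintype α] [DecidableEq α]

/-- A Donsker–Varadhan bound for an event that depends only on the restriction of the permutation
to `Q`. -/
theorem mul_sum_sub_le_sumMulLog_condAvg (Q : Finset α) {f s : Equiv.Perm α → ℝ}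
    (hf : f ∈ permDensities α) (hs : ∀ σ, s σ = 0 ∨ s σ = 1)
    (hsQ : ∀ σ, ∀ ρ ∈ pointwiseFixer Q, s (σ * ρ) = s σ) {l c : ℝ}
    (hc : 1 + (𝔼 σ, s σ) * (Real.exp l - 1) ≤ Real.exp c) :
    l * ∑ σ, f σ * s σ - c * Fintype.card (Equiv.Perm α) ≤ sumMulLog (condAvg Q f) := by
  set n := (Fintype.card (Equiv.Perm α) : ℝ)
  have hn : 0 < n := by simp only [n]; exact_mod_cast Fintype.card_pos
  have hexp : ∑ σ, Real.exp (l * s σ - c) ≤ n := by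
    have e : ∀ σ, Real.exp (l * s σ - c) = (1 + s σ * (Real.exp l - 1)) * Real.exp (-c) := by
      intro σ
      rw [sub_eq_add_neg, Real.exp_add]
      rcases hs σ with h | h <;> simp [h]
    simp_rw [e]
    rw [← Finset.sum_mul, Finset.sum_add_distrib, ← Finset.sum_mul]
    have hq : ∑ σ, s σ = n * 𝔼 σ, s σ := by
      rw [Fintype.expect_eq_sum_div_card]
      exact (mul_div_cancel₀ _ hn.ne').symm
    have h1 : ∑ _σ : Equiv.Perm α, (1 : ℝ) = n := by simp [n]
    rw [hq, h1]
    calc (n + n * (𝔼 σ, s σ) * (Real.exp l - 1)) * Real.exp (-c)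
        = n * (1 + (𝔼 σ, s σ) * (Real.exp l - 1)) * Real.exp (-c) := by ring
      _ ≤ n * Real.exp c * Real.exp (-c) := by gcongr
      _ = n := by rw [mul_assoc, ← Real.exp_add]; simp
  have hY := Finset.sum_le_sum fun σ (_ : σ ∈ Finset.univ) =>
    mul_le_mul_log_sub_add_exp (condAvg_nonneg Q hf.1 σ) (l * s σ - c)
  -- The event is determined on `Q`, so `condAvg Q f` may be replaced by `f` on the linear side,
  -- while the entropy stays that of the marginal.
  rw [sum_condAvg_mul Q f (fun σ => l * s σ - c)
    (fun σ ρ hρ => by simp only [hsQ σ ρ hρ])] at hY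
  rw [Finset.sum_add_distrib, Finset.sum_sub_distrib, sum_condAvg, hf.2] at hY
  have e : ∑ σ, f σ * (l * s σ - c) = l * ∑ σ, f σ * s σ - c * n := by
    simp only [mul_sub, Finset.sum_sub_distrib, ← Finset.sum_mul, hf.2, Finset.mul_sum]
    rw [mul_comm c]
    congr 1
    exact Finset.sum_congr rfl fun σ _ => by ring
  rw [e] at hY
  change _ ≤ sumMulLog (condAvg Q f) - n + _ at hY
  linarith

variable {ι : Type*} [Fintype ι]

/-- Conditioning a uniform permutation on a set `F` of permutations changes little, on average, the
probability of events that depend on few positions. -/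
theorem mul_sum_subset_le (Q : ι → Finset α) {κ : ℝ}
    (hκ : ∀ j, ((Finset.univ.filter fun d => j ∈ Q d).card : ℝ) ≤ κ)
    {F : Finset (Equiv.Perm α)} (hF : F.Nonempty) {s : ι → Equiv.Perm α → ℝ}
    (hs : ∀ d σ, s d σ = 0 ∨ s d σ = 1)
    (hsQ : ∀ d σ, ∀ ρ ∈ pointwiseFixer (Q d), s d (σ * ρ) = s d σ) {l : ℝ} {c : ι → ℝ}
    (hc : ∀ d, 1 + (𝔼 σ, s d σ) * (Real.exp l - 1) ≤ Real.exp (c d)) :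
    l * ∑ d, ∑ σ ∈ F, s d σ ≤
      F.card * ∑ d, c d +
        2 * κ * (F.card * Real.log (Fintype.card (Equiv.Perm α) / F.card)) := by
  set n := (Fintype.card (Equiv.Perm α) : ℝ)
  have hn : 0 < n := by simp only [n]; exact_mod_cast Fintype.card_pos
  have hk : (0 : ℝ) < F.card := by exact_mod_cast hF.card_pos
  set k := (F.card : ℝ)
  -- The density of the uniform law on `F`.
  set f : Equiv.Perm α → ℝ := fun σ => if σ ∈ F then n / k else 0
  have hsum : ∀ g : Equiv.Perm α → ℝ, ∑ σ, f σ * g σ = n / k * ∑ σ ∈ F, g σ := fun g => by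
    simp [f, ite_mul, Finset.sum_ite_mem, Finset.mul_sum]
  have hf : f ∈ permDensities α := by
    refine ⟨fun σ => ?_, ?_⟩
    · simp only [f]; split_ifs <;> positivity
    · have := hsum fun _ => 1
      simp only [mul_one, Finset.sum_const, nsmul_eq_mul] at this
      rw [this]
      change n / k * k = n
      field_simp
  have hent : sumMulLog f = n * Real.log (n / k) := by
    rw [sumMulLog, hsum]
    have : ∑ σ ∈ F, Real.log (f σ) = k * Real.log (n / k) := by
      rw [Finset.sum_congr rfl (g := fun _ => Real.log (n / k))
        fun σ hσ => by simp only [f, if_pos hσ]]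
      simp [k]
    rw [this]; field_simp
  have h1 := Finset.sum_le_sum fun d (_ : d ∈ Finset.univ) =>
    mul_sum_sub_le_sumMulLog_condAvg (Q d) hf (hs d) (hsQ d) (hc d)
  have h2 := h1.trans (shearer_perm Q hκ hf)
  simp_rw [hsum] at h2
  rw [hent, Finset.sum_sub_distrib, ← Finset.mul_sum, ← Finset.mul_sum, ← Finset.sum_mul] at h2
  have h3 := mul_le_mul_of_nonneg_left h2 (div_pos hk hn).le
  change k / n * (l * (n / k * _) - _ * n) ≤ _ at h3
  have e1 : k / n * (l * (n / k * ∑ d, ∑ σ ∈ F, s d σ) - (∑ d, c d) * n) =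
      l * (∑ d, ∑ σ ∈ F, s d σ) - k * ∑ d, c d := by field_simp
  have e2 : k / n * (2 * κ * (n * Real.log (n / k))) = 2 * κ * (k * Real.log (n / k)) := by
    field_simp
  rw [e1, e2] at h3
  linarith

end PermutationEntropy

/-! ### Entropy of the advice, and the optimal exponent -/

/-- The entropy of a function with values in `β` is at most `log |β|`. -/
theorem sum_card_fiber_mul_log_le {Ω β : Type*} [Fintype Ω] [Nonempty Ω] [Fintype β] [Nonempty β]
    [DecidableEq β] (g : Ω → β) :
    ∑ z, ((Finset.univ.filter fun x => g x = z).card : ℝ) *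
        Real.log (Fintype.card Ω / (Finset.univ.filter fun x => g x = z).card) ≤
      Fintype.card Ω * Real.log (Fintype.card β) := by
  have hn : (0 : ℝ) < Fintype.card Ω := by exact_mod_cast Fintype.card_pos
  have hb : (0 : ℝ) < Fintype.card β := by exact_mod_cast Fintype.card_pos
  set n := (Fintype.card Ω : ℝ)
  set b := (Fintype.card β : ℝ)
  set k : β → ℝ := fun z => ((Finset.univ.filter fun x => g x = z).card : ℝ) with hk
  have hsum : ∑ z, k z = n := by
    have := Finset.card_eq_sum_card_fiberwise (s := Finset.univ) (t := Finset.univ) (f := g)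
      (fun _ _ => by simp)
    simp only [hk, n]
    rw [← Finset.card_univ, this]
    push_cast
    rfl
  have hz : ∀ z, k z * Real.log (n / k z) ≤ n / b - k z + k z * Real.log b := by
    intro z
    have hk0 : 0 ≤ k z := Nat.cast_nonneg _
    rcases hk0.eq_or_lt with h | h
    · rw [← h]; simp; positivity
    have h1 := Real.log_le_sub_one_of_pos (x := n / k z / b) (by positivity)
    rw [Real.log_div (by positivity) (by positivity)] at h1
    have h2 := mul_le_mul_of_nonneg_left h1 h.le
    have h3 : k z * (n / k z / b - 1) = n / b - k z := by field_simp
    linarith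
  refine (Finset.sum_le_sum fun z _ => hz z).trans ?_
  rw [Finset.sum_add_distrib, Finset.sum_sub_distrib, ← Finset.sum_mul, hsum]
  have : ∑ _z : β, n / b = n := by
    rw [Finset.sum_const, Finset.card_univ, nsmul_eq_mul]
    change b * (n / b) = n
    field_simp
  rw [this]; linarith

/-- If `l * x ≤ l ^ 2 / 8 + 2 * c` for all `l > 0`, then `x ≤ √c`. -/
theorem le_sqrt_of_forall_mul_le {x c : ℝ}
    (h : ∀ l > 0, l * x ≤ l ^ 2 / 8 + 2 * c) : x ≤ Real.sqrt c := by
  by_contra! hlt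
  have hs := Real.sqrt_nonneg c
  have hx : 0 < x := hs.trans_lt hlt
  -- The choice l = 4x turns the hypothesis into 4x² ≤ 2x² + 2c, that is x² ≤ c.
  have h1 := h (4 * x) (by positivity)
  have h2 : c < x ^ 2 := (Real.sqrt_lt' hx).1 hlt
  nlinarith

/-! ### Application to challenge games -/

namespace PCGame

variable {N : ℕ} {D M V : Type*}

theorem card_filter_mem_le [Fintype D] {G : PCGame N D M V} {u : ℝ} (hG : G.IsUniform u)
    (L : List M) (j : Fin N) :
    ((Finset.univ.filter fun d => j ∈ (L.map (G.tr d)).toFinset).card : ℝ) ≤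
      L.length * (Fintype.card D / u) := by
  classical
  induction L with
  | nil => simp
  | cons m L ih =>
    have hsub : (Finset.univ.filter fun d => j ∈ ((m :: L).map (G.tr d)).toFinset) ⊆
        (Finset.univ.filter fun d => G.tr d m = j) ∪
          Finset.univ.filter fun d => j ∈ (L.map (G.tr d)).toFinset := by
      intro d
      simp only [Finset.mem_filter, Finset.mem_univ, true_and, Finset.mem_union, List.map_cons,
        List.toFinset_cons, Finset.mem_insert]
      rintro (h | h)
      · exact Or.inl h.symm
      · exact Or.inr h
    have h1 : ((Finset.univ.filter fun d => j ∈ ((m :: L).map (G.tr d)).toFinset).card : ℝ) ≤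
        (Finset.univ.filter fun d => G.tr d m = j).card +
          (Finset.univ.filter fun d => j ∈ (L.map (G.tr d)).toFinset).card := by
      exact_mod_cast (Finset.card_le_card hsub).trans (Finset.card_union_le _ _)
    have h2 := hG m j
    rw [List.length_cons]
    push_cast
    linarith

/-- The success indicator. -/
noncomputable def succInd (G : PCGame N D M V) (B : OnlineAlg N M V) (d : D)
    (σ : Equiv.Perm (Fin N)) : ℝ :=
  if G.succeeds B σ d then 1 else 0

theorem succInd_eq_zero_or_one (G : PCGame N D M V) (B : OnlineAlg N M V) (d : D)
    (σ : Equiv.Perm (Fin N)) : G.succInd B d σ = 0 ∨ G.succInd B d σ = 1 := by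
  unfold succInd; split_ifs <;> simp

/-- The predicate's own queries `G.verify` join those of the algorithm in the set of relevant
positions, which is why they count towards T. -/
theorem succInd_mul_right (G : PCGame N D M V) {B : OnlineAlg N M V} {L : List M}
    (hL : B.queries = L.map PCQuery.outer) (d : D) (σ : Equiv.Perm (Fin N))
    {ρ : Equiv.Perm (Fin N)}
    (hρ : ρ ∈ pointwiseFixer ((L ++ G.verify).map (G.tr d)).toFinset) :
    G.succInd B d (σ * ρ) = G.succInd B d σ := by
  rw [mem_pointwiseFixer] at hρ
  have horacle : ∀ m ∈ L ++ G.verify,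
      G.oracle (σ * ρ) d (.outer m) = G.oracle σ d (.outer m) := fun m hm => by
    simp only [oracle, Equiv.Perm.mul_apply]
    rw [hρ _ (List.mem_toFinset.2 (List.mem_map_of_mem hm))]
  have h1 : B.queries.map (G.oracle (σ * ρ) d) = B.queries.map (G.oracle σ d) := by
    rw [hL]
    refine List.map_congr_left fun q hq => ?_
    obtain ⟨m, hm, rfl⟩ := List.mem_map.1 hq
    exact horacle m (List.mem_append_left _ hm)
  have h2 : B.queries.map (fun q => (q, G.oracle (σ * ρ) d q)) =
      B.queries.map fun q => (q, G.oracle σ d q) := by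
    rw [hL]
    refine List.map_congr_left fun q hq => ?_
    obtain ⟨m, hm, rfl⟩ := List.mem_map.1 hq
    rw [horacle m (List.mem_append_left _ hm)]
  have h3 : G.verify.map (fun m => G.oracle (σ * ρ) d (.outer m)) =
      G.verify.map fun m => G.oracle σ d (.outer m) :=
    List.map_congr_left fun m hm => horacle m (List.mem_append_right _ hm)
  have h : G.succeeds B (σ * ρ) d = G.succeeds B σ d := by
    rw [succeeds, h1, h2, h3, succeeds]
  rw [succInd, h, succInd]

variable [Fintype D]

theorem successProb_eq [Nonempty D] (G : PCGame N D M V) (B : OnlineAlg N M V) :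
    ∑ d, 𝔼 σ, G.succInd B d σ = Fintype.card D * G.successProb B := by
  have hD : (Fintype.card D : ℝ) ≠ 0 := by exact_mod_cast Fintype.card_ne_zero
  simp only [successProb, Fintype.expect_eq_sum_div_card, Fintype.card_prod,
    Fintype.sum_prod_type_right, ← Finset.sum_div]
  push_cast
  change _ = _ * ((∑ d, ∑ σ, G.succInd B d σ) / _)
  field_simp

theorem successProb_le_maxS (G : PCGame N D M V) {T : ℕ} {B : OnlineAlg N M V}
    (hB : G.Admissible T B) : G.successProb B ≤ G.maxS T := by
  refine le_csSup ⟨1, ?_⟩ ⟨B, hB, rfl⟩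
  rintro _ ⟨B, _, rfl⟩
  rw [successProb, Fintype.expect_eq_sum_div_card]
  refine div_le_one_of_le₀ ?_ (Nat.cast_nonneg _)
  calc _ ≤ ∑ _x : Equiv.Perm (Fin N) × D, (1 : ℝ) :=
        Finset.sum_le_sum fun x _ => by split_ifs <;> norm_num
    _ = _ := by simp

theorem maxS_nonneg (G : PCGame N D M V) (T : ℕ) : 0 ≤ G.maxS T := by
  refine Real.sSup_nonneg ?_
  rintro _ ⟨B, _, rfl⟩
  exact Finset.expect_nonneg fun x _ => by split_ifs <;> norm_num

/-- The bound on the success of an online algorithm without inner queries, summed over the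
permutations of a set `F`. -/
theorem mul_sum_succInd_le [Nonempty D] {G : PCGame N D M V} {u : ℝ} (hu : 0 < u)
    (hG : G.IsUniform u) {T : ℕ} {B : OnlineAlg N M V} (hB : G.Admissible T B)
    (hBouter : ∀ q ∈ B.queries, ∃ m : M, q = PCQuery.outer m)
    {F : Finset (Equiv.Perm (Fin N))} (hF : F.Nonempty) {l a b : ℝ} (ha : 0 ≤ a)
    (hab : ∀ q, 0 ≤ q → q ≤ 1 → 1 + q * (Real.exp l - 1) ≤ Real.exp (a * q + b)) :
    l * ∑ d, ∑ σ ∈ F, G.succInd B d σ ≤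
      F.card * (Fintype.card D * (a * G.maxS T + b)) +
        2 * (T * (Fintype.card D / u)) *
          (F.card * Real.log (Fintype.card (Equiv.Perm (Fin N)) / F.card)) := by
  obtain ⟨L, hL⟩ : ∃ L : List M, B.queries = L.map PCQuery.outer := by
    have : B.queries ∈ Set.range (List.map (PCQuery.outer (N := N) (M := M))) := by
      rw [Set.range_list_map]
      intro q hq
      obtain ⟨m, rfl⟩ := hBouter q hq
      exact ⟨m, rfl⟩
    obtain ⟨L, h⟩ := this
    exact ⟨L, h.symm⟩
  have hlen : ((L ++ G.verify).length : ℝ) ≤ T := by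
    have := hB.1
    rw [hL, List.length_map] at this
    rw [List.length_append]
    exact_mod_cast this
  have h := mul_sum_subset_le (fun d => ((L ++ G.verify).map (G.tr d)).toFinset)
    (κ := T * (Fintype.card D / u))
    (fun j => (card_filter_mem_le hG (L ++ G.verify) j).trans (by gcongr)) hF
    (G.succInd_eq_zero_or_one B) (fun d σ ρ hρ => G.succInd_mul_right hL d σ hρ) (l := l)
    (c := fun d => a * (𝔼 σ, G.succInd B d σ) + b) (fun d => hab _
      (Finset.expect_nonneg fun σ _ => by
        rcases G.succInd_eq_zero_or_one B d σ with h | h <;> simp [h])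
      (Finset.expect_le Finset.univ_nonempty fun σ _ => by
        rcases G.succInd_eq_zero_or_one B d σ with h | h <;> simp [h]))
  refine h.trans (add_le_add_left (mul_le_mul_of_nonneg_left ?_ (Nat.cast_nonneg _)) _)
  rw [Finset.sum_add_distrib, ← Finset.mul_sum, successProb_eq]
  simp only [Finset.sum_const, Finset.card_univ, nsmul_eq_mul]
  have h1 := G.successProb_le_maxS hB
  have h2 : a * (Fintype.card D * G.successProb B) ≤ a * (Fintype.card D * G.maxS T) := by gcongr
  linarith

/-- The parameters a, b describe an exponential-moment estimate linear in q in the exponent.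
Linearity lets the success probabilities for the individual secrets be averaged and compared with
`maxS`. -/
theorem mul_successProbPre_le [Nonempty D] {G : PCGame N D M V} {u : ℝ} (hu : 0 < u)
    (hG : G.IsUniform u) {S T : ℕ} {A : PreprocessingAlg N M V} (hA : G.IsSTAlgorithm S T A)
    (hInner : A.NoInnerQueries) {l a b : ℝ} (ha : 0 ≤ a)
    (hab : ∀ q, 0 ≤ q → q ≤ 1 → 1 + q * (Real.exp l - 1) ≤ Real.exp (a * q + b)) :
    l * G.successProbPre A ≤ a * G.maxS T + b + 2 * (Real.log 2 * S * T / u) := by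
  have hD : (0 : ℝ) < Fintype.card D := by exact_mod_cast Fintype.card_pos
  have hn : (0 : ℝ) < Fintype.card (Equiv.Perm (Fin N)) := by exact_mod_cast Fintype.card_pos
  set n := (Fintype.card (Equiv.Perm (Fin N)) : ℝ)
  set F : (Fin A.adviceLen → Bool) → Finset (Equiv.Perm (Fin N)) := fun z =>
    Finset.univ.filter fun σ => A.pre σ = z with hFdef
  have hz : ∀ z, l * ∑ d, ∑ σ ∈ F z, G.succInd (A.online (A.pre σ)) d σ ≤
      (F z).card * (Fintype.card D * (a * G.maxS T + b)) +
        2 * (T * (Fintype.card D / u)) * ((F z).card * Real.log (n / (F z).card)) := by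
    intro z
    -- Admissibility is known only for advice that occurs; other strings have an empty fibre and
    -- contribute zero.
    rcases (F z).eq_empty_or_nonempty with h | h
    · simp [h]
    · obtain ⟨σ₀, h₀⟩ := h
      obtain rfl : A.pre σ₀ = z := (Finset.mem_filter.1 h₀).2
      have e : ∑ d, ∑ σ ∈ F (A.pre σ₀), G.succInd (A.online (A.pre σ)) d σ =
          ∑ d, ∑ σ ∈ F (A.pre σ₀), G.succInd (A.online (A.pre σ₀)) d σ :=
        Finset.sum_congr rfl fun d _ => Finset.sum_congr rfl fun σ hσ => by
          rw [(Finset.mem_filter.1 hσ).2]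
      rw [e]
      exact mul_sum_succInd_le hu hG (hA.2 σ₀) (hInner σ₀) ⟨σ₀, h₀⟩ ha hab
  have hsum := Finset.sum_le_sum fun z (_ : z ∈ Finset.univ) => hz z
  have hcard : ∑ z, ((F z).card : ℝ) = n := by
    have := Finset.card_eq_sum_card_fiberwise (s := Finset.univ) (t := Finset.univ) (f := A.pre)
      (fun _ _ => by simp)
    simp only [n]
    rw [← Finset.card_univ, this]
    push_cast
    rfl
  have hent : ∑ z, ((F z).card : ℝ) * Real.log (n / (F z).card) ≤ n * (S * Real.log 2) := by
    refine (sum_card_fiber_mul_log_le A.pre).trans ?_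
    have : Real.log (Fintype.card (Fin A.adviceLen → Bool)) = A.adviceLen * Real.log 2 := by
      simp
    rw [this]
    have hS : (A.adviceLen : ℝ) ≤ S := by exact_mod_cast hA.1
    have := Real.log_nonneg (one_le_two (α := ℝ))
    gcongr
  have hP : ∑ z, ∑ d, ∑ σ ∈ F z, G.succInd (A.online (A.pre σ)) d σ =
      n * Fintype.card D * G.successProbPre A := by
    rw [Finset.sum_comm]
    simp_rw [hFdef, Finset.sum_fiberwise]
    rw [successProbPre, Fintype.expect_eq_sum_div_card, Fintype.card_prod,
      Fintype.sum_prod_type_right]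
    push_cast
    change ∑ d, ∑ σ, G.succInd (A.online (A.pre σ)) d σ =
      n * _ * ((∑ d, ∑ σ, G.succInd (A.online (A.pre σ)) d σ) / (n * _))
    field_simp
  rw [← Finset.mul_sum, Finset.sum_add_distrib, ← Finset.sum_mul, ← Finset.mul_sum, hcard, hP]
    at hsum
  have hmul : 2 * (T * (Fintype.card D / u)) *
      ∑ z, ((F z).card : ℝ) * Real.log (n / (F z).card) ≤
        2 * (T * (Fintype.card D / u)) * (n * (S * Real.log 2)) := by gcongr
  refine le_of_mul_le_mul_left ?_ (mul_pos hn hD)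
  calc n * Fintype.card D * (l * G.successProbPre A)
      = l * (n * Fintype.card D * G.successProbPre A) := by ring
    _ ≤ _ := hsum.trans (add_le_add_right hmul _)
    _ = _ := by ring

end PCGame

/-! ### The two bounds -/

theorem theorem4p2 {N : ℕ} (hN : 0 < N) {D M V : Type*} [Fintype D] [Nonempty D]
    (G : PCGame N D M V) (u : ℝ) (hu : 0 < u) (hG : G.IsUniform u)
    (S T : ℕ) (A : PreprocessingAlg N M V)
    (hA : G.IsSTAlgorithm S T A) (hInner : A.NoInnerQueries) :
    G.successProbPre A ≤
      min (2 * G.maxS T + 4 * Real.log 2 * S * T / u)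
        (G.maxS T + Real.sqrt (Real.log 2 * S * T / u)) := by
  have hlog := Real.log_nonneg (one_le_two (α := ℝ))
  have hc : 0 ≤ Real.log 2 * S * T / u := by positivity
  have hM := G.maxS_nonneg T
  refine le_min ?_ ?_
  -- Here e - 1 ≤ 2 gives 1 + q(e - 1) ≤ 1 + 2q ≤ exp(2q). The additive term obtained is half of the
  -- one claimed.
  · have h := G.mul_successProbPre_le hu hG hA hInner (l := 1) (a := 2) (b := 0) zero_le_two
      fun q h0 _ => by
        refine le_trans ?_ (Real.add_one_le_exp _)
        have := Real.exp_one_lt_d9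
        nlinarith
    have e : 4 * Real.log 2 * S * T / u = 4 * (Real.log 2 * S * T / u) := by ring
    rw [e]
    linarith
  -- Hoeffding's estimate holds for every l > 0, and l is then optimised.
  · rw [← sub_le_iff_le_add']
    refine le_sqrt_of_forall_mul_le fun l hl => ?_
    have h := G.mul_successProbPre_le hu hG hA hInner (l := l) (a := l) (b := l ^ 2 / 8) hl.le
      fun q h0 h1 => bernoulli_mgf_le h0 h1 l
    linarith
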